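/- **Setting.** Let $X=(X,d,\mu)$ be a metric space with a Borel measure $\mu$ (measurability is understood with respect to the $\mu$-completion of the Borel $\sigma$-algebra) such that $0<\mu(B)<\infty$ for every ball $B=B(x,r)$, $r>0$. Let $1\le p<\infty$ and let $E\subset X$ be bounded. Curves are nonconstant, compact, rectifiable and parametrized by arc length, $\gamma:[0,l_\gamma]\to X$. A Borel function $g:X\to[0,\infty]$ is an *upper gradient* of $f:X\to[-\infty,\infty]$ if $|f(\gamma(0))-f(\gamma(l_\gamma))|\le\int_\gamma g\,ds$ for every curve $\gamma$, where the left-hand side is $\infty$ if both terms in it are infinite. A measurable $g:X\to[0,\infty]$ is a *$p$-weak upper gradient* of $f$ if this holds for $p$-almost every curve, i.e. if there is a Borel $\rho:X\to[0,\infty]$ with $\int_X\rho^p\,d\mu<\infty$ and $\int_\gamma\rho\,ds=\infty$ for every curve $\gamma$ for which it fails. The *minimal $p$-weak upper gradient* $g_f\in L^p_{\rm loc}(X)$ is the ($\mu$-a.e. unique) $p$-weak upper gradient of $f$ in $L^p_{\rm loc}(X)$ that is $\le g$ $\mu$-a.e. for all $p$-weak upper gradients $g\in L^p_{\rm loc}(X)$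 of $f$; it exists whenever $f$ has an upper gradient in $L^p_{\rm loc}(X)$. Here $g\in L^p_{\rm loc}(X)$ means that every point of $X$ is the center of a ball on which $g$ is $L^p$-integrable. $N^{1,p}(X)$ is the set of everywhere defined measurable functions $u:X\to[-\infty,\infty]$ that have an upper gradient in $L^p_{\rm loc}(X)$ and satisfy $$\|u\|_{N^{1,p}(X)}=\Bigl(\int_X|u|^p\,d\mu+\int_X g_u^p\,d\mu\Bigr)^{1/p}<\infty.$$ The *Sobolev capacity* of $A\subset X$ is $C_p(A)=\inf\|u\|_{N^{1,p}(X)}^p$ over all $u\in N^{1,p}(X)$ with $u=1$ on $A$. A function $u:X\to[-\infty,\infty]$ is *quasicontinuous* if for every $\varepsilon>0$ there is an open set $G$ with $C_p(G)<\varepsilon$ such that $u|_{X\setminus G}$ is real-valued and continuous. $N^{1,p}_0(E)$ is the set of $u\in N^{1,p}(X)$ with $u=0$ on $X\setminus E$ (identified with their restrictions to $E$), and for $A\subset E$ the *variational capacity* is $$\operatorname{cap}_p(A,E)=\inf\int_X g_u^p\,d\mu,$$ the infimum being taken over all $u\in N^{1,p}_0(E)$ with $u\ge1$ on $A$. As usual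 $\inf\varnothing=\infty$; in particular $\operatorname{dist}(A,B)=\inf_{x\in A,\,y\in B}d(x,y)=\infty$ if $A$ or $B$ is empty. **Theorem.** Assume that all functions in $N^{1,p}(X)$ are quasicontinuous. 1. If $p>1$, then $\operatorname{cap}_p(\,\cdot\,,E)$ is an outer capacity for sets in $\operatorname{int}E$: for every $A\subset\operatorname{int}E$, $$\operatorname{cap}_p(A,E)=\inf_{\substack{G\text{ open}\\ A\subset G\subset E}}\operatorname{cap}_p(G,E).\qquad(*)$$ 2. If $p=1$, then $(*)$ holds for every $A\subset E$ with $\operatorname{dist}(A,X\setminus E)>0$. -/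

import Mathlib

open MeasureTheory Set
open scoped ENNReal

namespace Newtonian

/-- A nonconstant, compact, rectifiable curve in `X`, given by its arc-length parametrization
`γ : [0, l_γ] → X` with `0 < l_γ < ∞`. (`toFun` is a total function, but only its values on
`[0, l_γ]` are ever used. Having unit speed on `[0, l_γ]` means that the length of `γ` between
parameters `s ≤ t` is `t - s`; in particular `γ` is `1`-Lipschitz there.) -/
structure ArcCurve (X : Type*) [MetricSpace X] where
  /-- the length of the curve -/
  length : ℝ
  /-- the parametrization by arc length -/
  toFun : ℝ → X
  length_pos : 0 < length
  unitSpeed : HasUnitSpeedOn toFun (Icc 0 length)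

/-- The line integral `∫_γ g ds`. -/
noncomputable def lineIntegral {X : Type*} [MetricSpace X] (γ : ArcCurve X) (g : X → ℝ≥0∞) :
    ℝ≥0∞ :=
  ∫⁻ t in Icc 0 γ.length, g (γ.toFun t)

/-- The upper gradient inequality `|f(γ(0)) - f(γ(l_γ))| ≤ ∫_γ g ds` along `γ`. In `EReal` one has
`⊤ - ⊤ = ⊥ - ⊥ = ⊥` and `|⊥| = ∞`, so the left-hand side is `∞` whenever at least one of the two
values is infinite. -/
def UGIneq {X : Type*} [MetricSpace X] (g : X → ℝ≥0∞) (f : X → EReal) (γ : ArcCurve X) : Prop :=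
  (f (γ.toFun 0) - f (γ.toFun γ.length)).abs ≤ lineIntegral γ g

/-- The convention on infinite values in the upper gradient inequality. -/
theorem abs_sub_eq_top_of_infinite (a b : EReal) (h : a = ⊤ ∨ a = ⊥ ∨ b = ⊤ ∨ b = ⊥) :
    (a - b).abs = ∞ := by
  induction a <;> induction b <;> simp_all

section

variable {X : Type*} [MetricSpace X] [MeasurableSpace X]

/-- A nonnegative Borel function `g` is an upper gradient of `f`. -/
def IsUpperGradient (g : X → ℝ≥0∞) (f : X → EReal) : Prop :=
  Measurable g ∧ ∀ γ : ArcCurve X, UGIneq g f γ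

/-- A property holds for `p`-almost every curve: the curves for which it fails form a family of zero
`p`-modulus, i.e. there is a nonnegative Borel `ρ ∈ L^p(X)` with `∫_γ ρ ds = ∞` for all of them. -/
def AlmostEveryCurve (p : ℝ) (μ : Measure X) (P : ArcCurve X → Prop) : Prop :=
  ∃ ρ : X → ℝ≥0∞, Measurable ρ ∧ ∫⁻ x, ρ x ^ p ∂μ < ∞ ∧ ∀ γ, ¬ P γ → lineIntegral γ ρ = ∞

/-- A nonnegative function `g`, measurable for the completion of `μ`, is a `p`-weak upper gradient
of `f`: for `p`-almost every curve the line integral of `g` is defined and the upper gradient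
inequality holds. -/
def IsWeakUpperGradient (p : ℝ) (μ : Measure X) (g : X → ℝ≥0∞) (f : X → EReal) : Prop :=
  AEMeasurable g μ ∧ AlmostEveryCurve p μ fun γ =>
    AEMeasurable (fun t => g (γ.toFun t)) (volume.restrict (Icc 0 γ.length)) ∧ UGIneq g f γ

/-- Membership of a nonnegative function in `L^p_loc(X)`: every point has a ball around it on which
`g` is `L^p`. -/
def MemLpLoc (p : ℝ) (μ : Measure X) (g : X → ℝ≥0∞) : Prop :=
  AEMeasurable g μ ∧ ∀ x, ∃ r : ℝ, 0 < r ∧ ∫⁻ y in Metric.ball x r, g y ^ p ∂μ < ∞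

/-- `g` is a minimal `p`-weak upper gradient of `f`. -/
def IsMinimalWeakUpperGradient (p : ℝ) (μ : Measure X) (g : X → ℝ≥0∞) (f : X → EReal) : Prop :=
  IsWeakUpperGradient p μ g f ∧ MemLpLoc p μ g ∧
    ∀ h : X → ℝ≥0∞, IsWeakUpperGradient p μ h f → MemLpLoc p μ h → g ≤ᵐ[μ] h

open Classical in
/-- The minimal `p`-weak upper gradient `g_f` of `f` (unique up to a.e. equality where it exists,
and the constant `∞` for functions that do not have one). -/
noncomputable def minGrad (p : ℝ) (μ : Measure X) (f : X → EReal) : X → ℝ≥0∞ :=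
  if h : ∃ g, IsMinimalWeakUpperGradient p μ g f then h.choose else fun _ => ∞

/-- The Newtonian norm `(∫ |u|^p dμ + ∫ g_u^p dμ)^{1/p}`, with values in `[0, ∞]`. -/
noncomputable def newtonNorm (p : ℝ) (μ : Measure X) (u : X → EReal) : ℝ≥0∞ :=
  (∫⁻ x, (u x).abs ^ p ∂μ + ∫⁻ x, minGrad p μ u x ^ p ∂μ) ^ (1 / p)

/-- `u ∈ N^{1,p}(X)`. Functions are defined everywhere, with values in `[-∞, ∞]`. -/
def MemNewton (p : ℝ) (μ : Measure X) (u : X → EReal) : Prop :=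
  AEMeasurable u μ ∧ (∃ g : X → ℝ≥0∞, IsUpperGradient g u ∧ MemLpLoc p μ g) ∧
    newtonNorm p μ u < ∞

/-- The Sobolev capacity `C_p(A)`. -/
noncomputable def sobolevCap (p : ℝ) (μ : Measure X) (A : Set X) : ℝ≥0∞ :=
  ⨅ (u : X → EReal) (_ : MemNewton p μ u) (_ : ∀ x ∈ A, u x = 1), newtonNorm p μ u ^ p

/-- `u` is quasicontinuous: for each `ε > 0` there is an open `G` with `C_p(G) < ε` such that the
restriction of `u` to `X \ G` is real-valued and continuous. -/
def Quasicontinuous (p : ℝ) (μ : Measure X) (u : X → EReal) : Prop :=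
  ∀ ε : ℝ≥0∞, 0 < ε → ∃ G : Set X, IsOpen G ∧ sobolevCap p μ G < ε ∧
    (∀ x ∈ Gᶜ, u x ≠ ⊤ ∧ u x ≠ ⊥) ∧ ContinuousOn u Gᶜ

/-- `u ∈ N^{1,p}_0(E)`, where an element of `N^{1,p}_0(E)` is identified with its extension by zero
to `X`. -/
def MemNewtonZero (p : ℝ) (μ : Measure X) (E : Set X) (u : X → EReal) : Prop :=
  MemNewton p μ u ∧ ∀ x ∈ Eᶜ, u x = 0

/-- The variational capacity `cap_p(A, E)`; the infimum over the empty set is `∞`. -/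
noncomputable def varCap (p : ℝ) (μ : Measure X) (A E : Set X) : ℝ≥0∞ :=
  ⨅ (u : X → EReal) (_ : MemNewtonZero p μ E u) (_ : ∀ x ∈ A, 1 ≤ u x),
    ∫⁻ x, minGrad p μ u x ^ p ∂μ

end

/-- The distance `dist(A, B)` between two sets; it is `∞` if one of them is empty. -/
noncomputable def setDist {X : Type*} [MetricSpace X] (A B : Set X) : ℝ≥0∞ :=
  ⨅ (x ∈ A) (y ∈ B), edist x y

end Newtonian

/-!
Let `u` be admissible for `cap_p(A, E)` and let `t > 1`. The theorem follows once some open `G` with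
`A ⊆ G ⊆ E` is found whose capacity exceeds `t ^ p ∫ g_u ^ p` by an arbitrarily small amount
(`Newtonian.iInf_varCap_le_mul_add`). By quasicontinuity of `u` there are open sets `V k` of
arbitrarily small Sobolev capacity outside which `u` is continuous, so that `{u > 1 / t}` agrees
outside `V k` with an open set `O k`. Let `v k` be equal to `1` on `V k` with small Sobolev norm,
let `η k` be the cutoff function `min 1 (k * dist(x, X \ E))`, and put
`w = sup (t * u, η k * v k)`, the functions `u` and `v k` being truncated to `[0, 1]`. Then `w`
vanishes outside `E` and `w ≥ 1` on
the union `G` of the open sets `(O k ∪ V k) ∩ {η k = 1}` (with `{η k = 1}` replaced by a slightly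
smaller open set), which contains `A` as soon as `A ⊆ int E`. The supremum of the weak upper
gradients of the competitors is one of `w`, and the integral of its `p`-th power is at most the sum
of the individual integrals. The factors, depending on `k`, which the cutoffs introduce are
compensated by the choice of `V k`. This works for all `p ≥ 1`, and a set at positive distance from
`X \ E` lies in `int E`, so both parts of the theorem are instances of
`Newtonian.varCap_eq_iInf_isOpen`.

The energy of `w` is defined through its minimal `p`-weak upper gradient, so the existence of the
latter is needed (`Newtonian.exists_isMinimalWeakUpperGradient`). It is the limit of a decreasing
sequence of weak upper gradients whose energies tend to the infimum; such a sequence exists because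
the minimum of two weak upper gradients in `L^p_loc` is again one
(`Newtonian.IsWeakUpperGradient.min`). That statement is proved without differentiating along
curves: an inequality between the increments of a function and an integral holds on an interval as
soon as it holds on all short subintervals
(`Newtonian.ofReal_abs_sub_le_lintegral_of_locally`), and near each parameter one of the two
gradients can be used. The same principle gives a Leibniz rule for the products `η k * v k`
(`Newtonian.UGIneqOnSubcurves.cutoff_mul`). To compare with gradients that are only in `L^p_loc`,
the space must be covered by countably many balls; it is separable because all balls have positive
and finite measure (`Newtonian.secondCountableTopology_of_measure_ball`).
-/

namespace Newtonian

/-! ### Curves and their subcurves -/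

namespace ArcCurve

variable {X : Type*} [MetricSpace X]

theorem lipschitzOnWith (γ : ArcCurve X) : LipschitzOnWith 1 γ.toFun (Icc 0 γ.length) := by
  have key : ∀ s ∈ Icc 0 γ.length, ∀ t ∈ Icc 0 γ.length, s ≤ t →
      edist (γ.toFun s) (γ.toFun t) ≤ edist s t := by
    intro s hs t ht hst
    have h := γ.unitSpeed hs ht
    have h2 := eVariationOn.edist_le γ.toFun (s := Icc 0 γ.length ∩ Icc s t)
      ⟨hs, left_mem_Icc.2 hst⟩ ⟨ht, right_mem_Icc.2 hst⟩
    rw [h] at h2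
    rw [edist_dist s t, Real.dist_eq, abs_sub_comm, abs_of_nonneg (sub_nonneg.2 hst)]
    simpa using h2
  intro s hs t ht
  rw [ENNReal.coe_one, one_mul]
  rcases le_total s t with h | h
  · exact key s hs t ht h
  · rw [edist_comm, edist_comm s]
    exact key t ht s hs h

theorem continuousOn (γ : ArcCurve X) : ContinuousOn γ.toFun (Icc 0 γ.length) :=
  γ.lipschitzOnWith.continuousOn

theorem aemeasurable [MeasurableSpace X] [BorelSpace X] (γ : ArcCurve X) :
    AEMeasurable γ.toFun (volume.restrict (Icc 0 γ.length)) :=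
  γ.continuousOn.aemeasurable measurableSet_Icc

theorem aemeasurable_comp [MeasurableSpace X] [BorelSpace X] (γ : ArcCurve X)
    {g : X → ℝ≥0∞} (hg : Measurable g) :
    AEMeasurable (fun t => g (γ.toFun t)) (volume.restrict (Icc 0 γ.length)) :=
  hg.comp_aemeasurable γ.aemeasurable

/-- The part of a curve between the parameters `s < t`. -/
def restrict (γ : ArcCurve X) {s t : ℝ} (hs : 0 ≤ s) (hst : s < t) (ht : t ≤ γ.length) :
    ArcCurve X where
  length := t - s
  toFun r := γ.toFun (s + r)
  length_pos := sub_pos.2 hst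
  unitSpeed := by
    intro x hx y hy
    have hm : MonotoneOn (fun r : ℝ => s + r) (Icc 0 (t - s) ∩ Icc x y) :=
      fun a _ b _ h => add_le_add_right h s
    have h1 := eVariationOn.comp_eq_of_monotoneOn γ.toFun _ hm
    have h2 : (fun r : ℝ => s + r) '' (Icc 0 (t - s) ∩ Icc x y)
        = Icc 0 γ.length ∩ Icc (s + x) (s + y) := by
      rw [Icc_inter_Icc, image_const_add_Icc, Icc_inter_Icc]
      congr 1
      · rw [max_eq_right hx.1, max_eq_right (by linarith [hx.1])]
      · rw [min_eq_right hy.2, min_eq_right (by linarith [hy.2])]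
    rw [h2] at h1
    have h3 := γ.unitSpeed (x := s + x) ⟨by linarith [hx.1], by linarith [hx.2]⟩
      (y := s + y) ⟨by linarith [hy.1], by linarith [hy.2]⟩
    rw [h3] at h1
    refine h1.trans ?_
    congr 2
    ring

theorem lineIntegral_restrict (γ : ArcCurve X) {s t : ℝ} (hs : 0 ≤ s) (hst : s < t)
    (ht : t ≤ γ.length) (g : X → ℝ≥0∞) :
    lineIntegral (γ.restrict hs hst ht) g = ∫⁻ r in Icc s t, g (γ.toFun r) := by
  have hmp := measurePreserving_add_left (volume : Measure ℝ) s
  have h := hmp.setLIntegral_comp_emb (measurableEmbedding_addLeft s)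
    (fun r => g (γ.toFun r)) (Icc 0 (t - s))
  rw [image_const_add_Icc, add_zero, add_sub_cancel] at h
  exact h

theorem lineIntegral_restrict_le (γ : ArcCurve X) {s t : ℝ} (hs : 0 ≤ s) (hst : s < t)
    (ht : t ≤ γ.length) (g : X → ℝ≥0∞) :
    lineIntegral (γ.restrict hs hst ht) g ≤ lineIntegral γ g := by
  rw [lineIntegral_restrict]
  exact lintegral_mono_set (Icc_subset_Icc hs ht)

end ArcCurve

/-- The upper gradient inequality holds along every nondegenerate subcurve of `γ`. -/
def UGIneqOnSubcurves {X : Type*} [MetricSpace X] (g : X → ℝ≥0∞) (f : X → EReal)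
    (γ : ArcCurve X) : Prop :=
  ∀ ⦃s t : ℝ⦄, 0 ≤ s → s < t → t ≤ γ.length →
    (f (γ.toFun s) - f (γ.toFun t)).abs ≤ ∫⁻ r in Icc s t, g (γ.toFun r)

theorem lintegral_iSup_rpow_le_tsum {α ι : Type*} [MeasurableSpace α] {μ : Measure α} [Countable ι]
    {p : ℝ} (hp : 0 < p) {g : ι → α → ℝ≥0∞} (hg : ∀ i, AEMeasurable (g i) μ) :
    ∫⁻ x, (⨆ i, g i x) ^ p ∂μ ≤ ∑' i, ∫⁻ x, g i x ^ p ∂μ := by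
  rw [← lintegral_tsum fun i => (hg i).pow_const p]
  refine lintegral_mono fun x => ?_
  rw [← ENNReal.orderIsoRpow_apply p hp, OrderIso.map_iSup]
  exact iSup_le fun i => ENNReal.le_tsum (f := fun i => g i x ^ p) i

/-! ### Properties of almost every curve -/

section AlmostEveryCurve

variable {X : Type*} [MetricSpace X] [MeasurableSpace X] {μ : Measure X} {p : ℝ}

theorem AlmostEveryCurve.mono {P Q : ArcCurve X → Prop} (h : AlmostEveryCurve p μ P)
    (hPQ : ∀ γ, P γ → Q γ) : AlmostEveryCurve p μ Q := by
  obtain ⟨ρ, h1, h2, h3⟩ := h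
  exact ⟨ρ, h1, h2, fun γ hγ => h3 γ fun hP => hγ (hPQ γ hP)⟩

/-- The exceptional families of curves are stable under countable unions: the functions `ρ i`
witnessing this for each family are combined into `sup c i * ρ i` with small constants `c i > 0`,
which avoids any appeal to Minkowski's inequality. -/
theorem AlmostEveryCurve.countable_forall {ι : Type*} [Countable ι] (hp : 0 < p)
    {P : ι → ArcCurve X → Prop} (h : ∀ i, AlmostEveryCurve p μ (P i)) :
    AlmostEveryCurve p μ fun γ => ∀ i, P i γ := by
  choose ρ hρ hI hfail using h
  obtain ⟨δ, hδ, hsum⟩ := ENNReal.exists_pos_sum_of_countable' one_ne_zero ι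
  have hδt : ∀ i, δ i ≠ ∞ := fun i =>
    ((ENNReal.le_tsum i).trans_lt (hsum.trans ENNReal.one_lt_top)).ne
  let c : ι → ℝ≥0∞ := fun i => (δ i / (∫⁻ x, ρ i x ^ p ∂μ + 1)) ^ (1 / p)
  have hcp : ∀ i, c i ^ p * ∫⁻ x, ρ i x ^ p ∂μ ≤ δ i := by
    intro i
    have : c i ^ p = δ i / (∫⁻ x, ρ i x ^ p ∂μ + 1) := by
      simp only [c]
      rw [← ENNReal.rpow_mul, one_div_mul_cancel hp.ne', ENNReal.rpow_one]
    rw [this]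
    calc _ ≤ δ i / (∫⁻ x, ρ i x ^ p ∂μ + 1) * (∫⁻ x, ρ i x ^ p ∂μ + 1) := by
          gcongr; exact le_self_add
      _ = δ i := ENNReal.div_mul_cancel (by simp)
        (ENNReal.add_ne_top.2 ⟨(hI i).ne, ENNReal.one_ne_top⟩)
  have hc0 : ∀ i, c i ≠ 0 := by
    intro i
    have hpos : 0 < δ i / (∫⁻ x, ρ i x ^ p ∂μ + 1) :=
      ENNReal.div_pos (hδ i).ne' (ENNReal.add_ne_top.2 ⟨(hI i).ne, ENNReal.one_ne_top⟩)
    exact (ENNReal.rpow_pos hpos (ENNReal.div_ne_top (hδt i) (by simp))).ne'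
  refine ⟨fun x => ⨆ i, c i * ρ i x, .iSup fun i => (hρ i).const_mul _, ?_, ?_⟩
  · calc ∫⁻ x, (⨆ i, c i * ρ i x) ^ p ∂μ ≤ ∑' i, ∫⁻ x, (c i * ρ i x) ^ p ∂μ :=
          lintegral_iSup_rpow_le_tsum hp fun i => ((hρ i).const_mul _).aemeasurable
      _ = ∑' i, c i ^ p * ∫⁻ x, ρ i x ^ p ∂μ := by
          simp only [ENNReal.mul_rpow_of_nonneg _ _ hp.le]
          exact tsum_congr fun i => lintegral_const_mul _ ((hρ i).pow_const p)
      _ ≤ ∑' i, δ i := ENNReal.tsum_le_tsum hcp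
      _ < ∞ := hsum.trans ENNReal.one_lt_top
  · intro γ hγ
    obtain ⟨i, hi⟩ := not_forall.1 hγ
    rw [eq_top_iff]
    calc ∞ = c i * lineIntegral γ (ρ i) := by rw [hfail i γ hi, ENNReal.mul_top (hc0 i)]
      _ ≤ ∫⁻ t in Icc 0 γ.length, c i * ρ i (γ.toFun t) := lintegral_const_mul_le _ _
      _ ≤ lineIntegral γ fun x => ⨆ i, c i * ρ i x :=
        lintegral_mono fun t => le_iSup (fun i => c i * ρ i (γ.toFun t)) i

theorem AlmostEveryCurve.and (hp : 0 < p) {P Q : ArcCurve X → Prop}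
    (hP : AlmostEveryCurve p μ P) (hQ : AlmostEveryCurve p μ Q) :
    AlmostEveryCurve p μ fun γ => P γ ∧ Q γ := by
  refine (AlmostEveryCurve.countable_forall (P := fun b : Bool => cond b P Q) hp ?_).mono
    fun γ h => ⟨h true, h false⟩
  rintro (_ | _)
  exacts [hQ, hP]

/-- A property of almost every curve is shared by all subcurves of almost every curve. -/
theorem AlmostEveryCurve.restrict {P : ArcCurve X → Prop} (h : AlmostEveryCurve p μ P) :
    AlmostEveryCurve p μ fun γ => ∀ ⦃s t : ℝ⦄ (hs : 0 ≤ s) (hst : s < t) (ht : t ≤ γ.length),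
      P (γ.restrict hs hst ht) := by
  obtain ⟨ρ, h1, h2, h3⟩ := h
  refine ⟨ρ, h1, h2, fun γ hγ => ?_⟩
  push Not at hγ
  obtain ⟨s, t, hs, hst, ht, hP⟩ := hγ
  exact eq_top_iff.2 ((h3 _ hP).ge.trans (γ.lineIntegral_restrict_le hs hst ht ρ))

theorem almostEveryCurve_lineIntegral_ne_top {g : X → ℝ≥0∞} (hg : Measurable g)
    (hI : ∫⁻ x, g x ^ p ∂μ < ∞) : AlmostEveryCurve p μ fun γ => lineIntegral γ g ≠ ∞ :=
  ⟨g, hg, hI, fun _ h => not_not.1 h⟩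

/-- Almost every curve spends no time in a given null set. -/
theorem almostEveryCurve_ae_of_ae [BorelSpace X] (hp : 0 < p) {P : X → Prop}
    (h : ∀ᵐ x ∂μ, P x) :
    AlmostEveryCurve p μ fun γ => ∀ᵐ t ∂volume.restrict (Icc 0 γ.length), P (γ.toFun t) := by
  let N := toMeasurable μ {x | ¬ P x}
  have hN : MeasurableSet N := measurableSet_toMeasurable _ _
  have hN0 : μ N = 0 := by rw [measure_toMeasurable]; exact h
  have hm : Measurable (N.indicator fun _ => ∞ : X → ℝ≥0∞) := measurable_const.indicator hN
  refine ⟨N.indicator fun _ => ∞, hm, ?_, fun γ hγ => ?_⟩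
  · have : ∫⁻ x, (N.indicator (fun _ => ∞) x : ℝ≥0∞) ^ p ∂μ = 0 := by
      rw [lintegral_eq_zero_iff (hm.pow_const p)]
      filter_upwards [measure_eq_zero_iff_ae_notMem.1 hN0] with x hx
      simp [hx, hp]
    simp [this]
  · by_contra hfin
    refine hγ ?_
    filter_upwards [ae_lt_top' (γ.aemeasurable_comp hm) hfin] with t ht
    by_contra hP
    have : γ.toFun t ∈ N := subset_toMeasurable _ _ hP
    simp [this] at ht

end AlmostEveryCurve

/-! ### Separability -/

section Separable

variable {X : Type*} [MetricSpace X] [MeasurableSpace X] [BorelSpace X] {μ : Measure X}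

/-- If all balls have positive and finite measure, then the space is separable: the balls of
radius `ε / 2` around the points of a maximal `ε`-separated set are disjoint, and a `σ`-finite
measure charges only countably many members of a disjoint family. -/
theorem secondCountableTopology_of_measure_ball
    (hμ : ∀ (x : X) (r : ℝ), 0 < r → 0 < μ (Metric.ball x r) ∧ μ (Metric.ball x r) < ∞) :
    SecondCountableTopology X := by
  rcases isEmpty_or_nonempty X with hX | ⟨⟨x₀⟩⟩
  · infer_instance
  have : SigmaFinite μ := by
    refine ⟨⟨⟨fun n : ℕ => Metric.ball x₀ (n + 1), fun _ => trivial,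
      fun n => (hμ x₀ _ (by positivity)).2, ?_⟩⟩⟩
    refine eq_univ_of_forall fun x => mem_iUnion.2 ?_
    obtain ⟨n, hn⟩ := exists_nat_gt (dist x x₀)
    exact ⟨n, Metric.mem_ball.2 (by linarith)⟩
  refine Metric.secondCountable_of_almost_dense_set fun ε hε => ?_
  obtain ⟨S, hS⟩ := zorn_subset {S : Set X | S.Pairwise fun x y => ε < dist x y} (by
    intro C hC hchain
    refine ⟨⋃₀ C, ?_, fun s hs => subset_sUnion_of_mem hs⟩
    exact (pairwise_sUnion hchain.directedOn).2 fun s hs => hC hs)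
  refine ⟨S, ?_, fun x => ?_⟩
  · have hd : Pairwise (Function.onFun Disjoint fun x : S => Metric.ball (x : X) (ε / 2)) := by
      intro x y hxy
      refine Metric.ball_disjoint_ball ?_
      have := hS.prop x.2 y.2 (Subtype.coe_injective.ne hxy)
      linarith
    have hc := Measure.countable_meas_pos_of_disjoint_iUnion (μ := μ)
      (fun x : S => (Metric.isOpen_ball (x := (x : X)) (ε := ε / 2)).measurableSet) hd
    have : {x : S | 0 < μ (Metric.ball (x : X) (ε / 2))} = univ :=
      eq_univ_of_forall fun x => (hμ x _ (half_pos hε)).1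
    rw [this, countable_univ_iff] at hc
    exact hc
  · by_contra! hfar
    have hins : insert x S ∈ {S : Set X | S.Pairwise fun x y => ε < dist x y} := by
      refine hS.prop.insert fun y hy _ => ⟨hfar y hy, ?_⟩
      rw [dist_comm]; exact hfar y hy
    have hx : x ∈ S := hS.le_of_ge hins (subset_insert x S) (mem_insert x S)
    have := hfar x hx
    rw [dist_self] at this
    exact absurd this hε.not_gt

end Separable

/-! ### Increments and integrals on an interval -/

section Interval

theorem lintegral_Icc_add_Icc {a b c : ℝ} (hab : a ≤ b) (hbc : b ≤ c) (K : ℝ → ℝ≥0∞) :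
    (∫⁻ r in Icc a b, K r) + ∫⁻ r in Icc b c, K r = ∫⁻ r in Icc a c, K r := by
  rw [← Icc_union_Ioc_eq_Icc hab hbc,
    lintegral_union measurableSet_Ioc (disjoint_left.2 fun x hx hx' => hx.2.not_gt hx'.1),
    setLIntegral_congr (Ioc_ae_eq_Icc (a := b) (b := c))]

theorem ofReal_abs_sub_le_add (x y z : ℝ) :
    ENNReal.ofReal |x - z| ≤ ENNReal.ofReal |x - y| + ENNReal.ofReal |y - z| := by
  rw [← ENNReal.ofReal_add (abs_nonneg _) (abs_nonneg _)]
  exact ENNReal.ofReal_le_ofReal (abs_sub_le x y z)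

/-- The inequality `|F a - F b| ≤ ∫ K` over an interval follows from its validity on all
sufficiently short subintervals. -/
theorem ofReal_abs_sub_le_lintegral_of_locally {F : ℝ → ℝ} {K : ℝ → ℝ≥0∞} {a b : ℝ} (hab : a ≤ b)
    (h : ∀ x ∈ Icc a b, ∃ δ > 0, ∀ s t, a ≤ s → s ≤ t → t ≤ b → dist s x < δ → dist t x < δ →
      ENNReal.ofReal |F s - F t| ≤ ∫⁻ r in Icc s t, K r) :
    ENNReal.ofReal |F a - F b| ≤ ∫⁻ r in Icc a b, K r := by
  choose! δ hδ hF using h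
  obtain ⟨t, ht0, htm, ⟨m, hm⟩, hc⟩ := exists_monotone_Icc_subset_open_cover_Icc hab
    (c := fun x : Icc a b => Metric.ball x (δ x)) (fun _ => Metric.isOpen_ball)
    (fun x _ => mem_iUnion.2 ⟨x, Metric.mem_ball_self (hδ x x.2)⟩)
  have key : ∀ n, ENNReal.ofReal |F a - F (t n)| ≤ ∫⁻ r in Icc a (t n), K r := by
    intro n
    induction n with
    | zero => simp [ht0]
    | succ n ih =>
      obtain ⟨x, hx⟩ := hc n
      have hle : t n ≤ t (n + 1) := htm n.le_succ
      have h1 := hF x x.2 (t n) (t (n + 1)) (t n).2.1 hle (t (n + 1)).2.2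
        (hx (left_mem_Icc.2 hle)) (hx (right_mem_Icc.2 hle))
      rw [← lintegral_Icc_add_Icc (t n).2.1 (b := (t n : ℝ)) (c := t (n + 1)) hle]
      exact (ofReal_abs_sub_le_add _ (F (t n)) _).trans (add_le_add ih h1)
  have := key m
  rwa [hm m le_rfl] at this

/-- Absolute continuity of the integral, from the outside: a measurable set has an open
neighbourhood in which `g` has almost no more mass on `[a, b]`. -/
theorem exists_isOpen_lintegral_diff_le {g : ℝ → ℝ≥0∞} {a b : ℝ}
    (hgi : ∫⁻ r in Icc a b, g r ≠ ∞) {D : Set ℝ} (hD : MeasurableSet D) {ε : ℝ≥0∞} (hε : ε ≠ 0) :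
    ∃ U, D ⊆ U ∧ IsOpen U ∧ ∫⁻ r in Icc a b, (U \ D).indicator g r ≤ ε := by
  let ν := (volume.restrict (Icc a b)).withDensity g
  have : IsFiniteMeasure ν := isFiniteMeasure_withDensity hgi
  obtain ⟨U, hDU, hU, -, hlt⟩ := hD.exists_isOpen_sdiff_lt (μ := ν) (measure_ne_top ν D) hε
  refine ⟨U, hDU, hU, ?_⟩
  rw [lintegral_indicator (hU.measurableSet.diff hD),
    ← withDensity_apply _ (hU.measurableSet.diff hD)]
  exact hlt.le

/-- If two integrable functions both control the increments of `F`, then so does their minimum.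
On a neighbourhood `U` of `D = {g ≤ h}` the increments are controlled by `g`, which exceeds the
minimum only on `U \ D`, where it has small integral; `h` is used in the same way near `Dᶜ`. -/
theorem ofReal_abs_sub_le_lintegral_min {F : ℝ → ℝ} {g h : ℝ → ℝ≥0∞} {a b : ℝ} (hab : a ≤ b)
    (hg : Measurable g) (hh : Measurable h)
    (hgi : ∫⁻ r in Icc a b, g r ≠ ∞) (hhi : ∫⁻ r in Icc a b, h r ≠ ∞)
    (hFg : ∀ s t, a ≤ s → s ≤ t → t ≤ b → ENNReal.ofReal |F s - F t| ≤ ∫⁻ r in Icc s t, g r)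
    (hFh : ∀ s t, a ≤ s → s ≤ t → t ≤ b → ENNReal.ofReal |F s - F t| ≤ ∫⁻ r in Icc s t, h r) :
    ENNReal.ofReal |F a - F b| ≤ ∫⁻ r in Icc a b, min (g r) (h r) := by
  refine ENNReal.le_of_forall_pos_le_add fun ε hε _ => ?_
  have hε2 : (ε : ℝ≥0∞) / 2 ≠ 0 := by simpa using hε.ne'
  let D : Set ℝ := {r | g r ≤ h r}
  have hD : MeasurableSet D := measurableSet_le hg hh
  obtain ⟨U, hDU, hU, hUε⟩ := exists_isOpen_lintegral_diff_le hgi hD hε2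
  obtain ⟨V, hDV, hV, hVε⟩ := exists_isOpen_lintegral_diff_le hhi hD.compl hε2
  -- `K` dominates `g` on `U` and `h` on `V`, and exceeds the minimum by at most `ε` in integral.
  let K : ℝ → ℝ≥0∞ := fun r => min (g r) (h r) + ((U \ D).indicator g r + (V \ Dᶜ).indicator h r)
  have hgK : ∀ r ∈ U, g r ≤ K r := by
    intro r hr
    by_cases hrD : r ∈ D
    · exact (min_eq_left (a := g r) (b := h r) hrD).ge.trans le_self_add
    · have : r ∈ U \ D := ⟨hr, hrD⟩
      simp only [K, indicator_of_mem this]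
      exact le_self_add.trans le_add_self
  have hhK : ∀ r ∈ V, h r ≤ K r := by
    intro r hr
    by_cases hrD : r ∈ Dᶜ
    · exact (min_eq_right (a := g r) (b := h r) (le_of_not_ge hrD)).ge.trans le_self_add
    · have : r ∈ V \ Dᶜ := ⟨hr, hrD⟩
      simp only [K, indicator_of_mem this]
      exact le_add_self.trans le_add_self
  have hK : ENNReal.ofReal |F a - F b| ≤ ∫⁻ r in Icc a b, K r := by
    refine ofReal_abs_sub_le_lintegral_of_locally hab fun x _ => ?_
    have hball : ∀ {W : Set ℝ} {δ s t r : ℝ}, Metric.ball x δ ⊆ W → dist s x < δ →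
        dist t x < δ → r ∈ Icc s t → r ∈ W := by
      intro W δ s t r hW hs ht hr
      refine hW ?_
      rw [Real.ball_eq_Ioo]
      rw [Real.dist_eq, abs_lt] at hs ht
      exact ⟨by linarith [hr.1], by linarith [hr.2]⟩
    by_cases hx : x ∈ D
    · obtain ⟨δ, hδ, hδU⟩ := Metric.isOpen_iff.1 hU x (hDU hx)
      exact ⟨δ, hδ, fun s t has hst htb hs ht => (hFg s t has hst htb).trans <|
        setLIntegral_mono' measurableSet_Icc fun r hr => hgK r (hball hδU hs ht hr)⟩
    · obtain ⟨δ, hδ, hδV⟩ := Metric.isOpen_iff.1 hV x (hDV hx)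
      exact ⟨δ, hδ, fun s t has hst htb hs ht => (hFh s t has hst htb).trans <|
        setLIntegral_mono' measurableSet_Icc fun r hr => hhK r (hball hδV hs ht hr)⟩
  refine hK.trans ?_
  simp only [K]
  rw [lintegral_add_left (hg.min hh),
    lintegral_add_left (hg.indicator (hU.measurableSet.diff hD))]
  gcongr
  calc _ ≤ (ε : ℝ≥0∞) / 2 + ε / 2 := add_le_add hUε hVε
    _ = ε := ENNReal.add_halves _

end Interval

/-! ### Weak upper gradients and the minimal one -/

section WeakUpperGradient

variable {X : Type*} [MetricSpace X]

/-- A function with a gradient of finite integral along all subcurves of `γ` is real-valued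
on `γ`. -/
theorem UGIneqOnSubcurves.exists_real {g : X → ℝ≥0∞} {f : X → EReal} {γ : ArcCurve X}
    (h : UGIneqOnSubcurves g f γ) (hfin : lineIntegral γ g ≠ ∞) :
    ∃ F : ℝ → ℝ, (∀ r ∈ Icc 0 γ.length, f (γ.toFun r) = F r) ∧
      ∀ s t, 0 ≤ s → s ≤ t → t ≤ γ.length →
        ENNReal.ofReal |F s - F t| ≤ ∫⁻ r in Icc s t, g (γ.toFun r) := by
  have hne : ∀ ⦃s t : ℝ⦄, 0 ≤ s → s < t → t ≤ γ.length →
      (f (γ.toFun s) - f (γ.toFun t)).abs ≠ ∞ := fun s t hs hst ht =>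
    ((h hs hst ht).trans_lt ((lintegral_mono_set (Icc_subset_Icc hs ht)).trans_lt
      (lt_top_iff_ne_top.2 hfin))).ne
  have hreal : ∀ r ∈ Icc 0 γ.length, f (γ.toFun r) = ((f (γ.toFun r)).toReal : EReal) := by
    intro r hr
    symm
    rcases hr.2.lt_or_eq with hlt | rfl
    · have := mt (abs_sub_eq_top_of_infinite _ _) (hne hr.1 hlt le_rfl)
      exact EReal.coe_toReal (fun h => this (Or.inl h)) fun h => this (Or.inr (Or.inl h))
    · have := mt (abs_sub_eq_top_of_infinite _ _) (hne le_rfl γ.length_pos le_rfl)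
      exact EReal.coe_toReal (fun h => this (Or.inr (Or.inr (Or.inl h))))
        fun h => this (Or.inr (Or.inr (Or.inr h)))
  refine ⟨fun r => (f (γ.toFun r)).toReal, hreal, fun s t hs hst ht => ?_⟩
  rcases hst.eq_or_lt with rfl | hlt
  · simp
  · have := h hs hlt ht
    rwa [hreal s ⟨hs, hst.trans ht⟩, hreal t ⟨hs.trans hst, ht⟩, ← EReal.coe_sub,
      EReal.abs_def] at this

theorem setLIntegral_congr_of_ae_Icc {γ : ArcCurve X} {g : X → ℝ≥0∞} {G : ℝ → ℝ≥0∞}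
    (h : ∀ᵐ t ∂volume.restrict (Icc 0 γ.length), g (γ.toFun t) = G t) {s t : ℝ} (hs : 0 ≤ s)
    (ht : t ≤ γ.length) : ∫⁻ r in Icc s t, g (γ.toFun r) = ∫⁻ r in Icc s t, G r :=
  lintegral_congr_ae (ae_restrict_of_ae_restrict_of_subset (Icc_subset_Icc hs ht) h)

theorem UGIneqOnSubcurves.ugIneq_min {g h : X → ℝ≥0∞} {f : X → EReal} {γ : ArcCurve X}
    (hg : UGIneqOnSubcurves g f γ) (hh : UGIneqOnSubcurves h f γ)
    (hgm : AEMeasurable (fun t => g (γ.toFun t)) (volume.restrict (Icc 0 γ.length)))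
    (hhm : AEMeasurable (fun t => h (γ.toFun t)) (volume.restrict (Icc 0 γ.length)))
    (hgi : lineIntegral γ g ≠ ∞) (hhi : lineIntegral γ h ≠ ∞) :
    UGIneq (fun x => min (g x) (h x)) f γ := by
  obtain ⟨F, hF, hFg⟩ := hg.exists_real hgi
  have hFh : ∀ s t, 0 ≤ s → s ≤ t → t ≤ γ.length →
      ENNReal.ofReal |F s - F t| ≤ ∫⁻ r in Icc s t, h (γ.toFun r) := by
    intro s t hs hst ht
    rcases hst.eq_or_lt with rfl | hlt
    · simp
    · have := hh hs hlt ht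
      rwa [hF s ⟨hs, hst.trans ht⟩, hF t ⟨hs.trans hst, ht⟩, ← EReal.coe_sub,
        EReal.abs_def] at this
  have hl := γ.length_pos.le
  unfold UGIneq
  rw [hF 0 (left_mem_Icc.2 hl), hF _ (right_mem_Icc.2 hl), ← EReal.coe_sub, EReal.abs_def]
  have hmin : ∀ᵐ t ∂volume.restrict (Icc 0 γ.length),
      min (g (γ.toFun t)) (h (γ.toFun t)) = min (hgm.mk _ t) (hhm.mk _ t) := by
    filter_upwards [hgm.ae_eq_mk, hhm.ae_eq_mk] with t h1 h2
    rw [h1, h2]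
  rw [lineIntegral, lintegral_congr_ae hmin]
  refine ofReal_abs_sub_le_lintegral_min hl hgm.measurable_mk hhm.measurable_mk ?_ ?_ ?_ ?_
  · rw [← lintegral_congr_ae hgm.ae_eq_mk]; exact hgi
  · rw [← lintegral_congr_ae hhm.ae_eq_mk]; exact hhi
  · intro s t hs hst ht
    rw [← setLIntegral_congr_of_ae_Icc hgm.ae_eq_mk hs ht]
    exact hFg s t hs hst ht
  · intro s t hs hst ht
    rw [← setLIntegral_congr_of_ae_Icc hhm.ae_eq_mk hs ht]
    exact hFh s t hs hst ht

variable [MeasurableSpace X] {μ : Measure X} {p : ℝ} {f : X → EReal} {g h : X → ℝ≥0∞}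

theorem IsWeakUpperGradient.ugIneqOnSubcurves (hg : IsWeakUpperGradient p μ g f) :
    AlmostEveryCurve p μ fun γ => UGIneqOnSubcurves g f γ := by
  refine hg.2.restrict.mono fun γ hγ s t hs hst ht => ?_
  have h1 := (hγ hs hst ht).2
  rw [UGIneq, γ.lineIntegral_restrict hs hst ht] at h1
  simpa [ArcCurve.restrict] using h1

theorem MemLpLoc.of_lintegral_lt_top (hg : AEMeasurable g μ) (hI : ∫⁻ x, g x ^ p ∂μ < ∞) :
    MemLpLoc p μ g :=
  ⟨hg, fun _ => ⟨1, one_pos, (setLIntegral_le_lintegral _ _).trans_lt hI⟩⟩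

theorem isMinimalWeakUpperGradient_minGrad (h : ∃ g, IsMinimalWeakUpperGradient p μ g f) :
    IsMinimalWeakUpperGradient p μ (minGrad p μ f) f := by
  rw [minGrad, dif_pos h]
  exact h.choose_spec

/-- `minGrad p μ f` is always a weak upper gradient of `f`: where no minimal one exists, it is the
constant `∞`, whose integral along any curve is infinite. -/
theorem isWeakUpperGradient_minGrad (hp : 0 < p) (μ : Measure X) (f : X → EReal) :
    IsWeakUpperGradient p μ (minGrad p μ f) f := by
  by_cases h : ∃ g, IsMinimalWeakUpperGradient p μ g f
  · exact (isMinimalWeakUpperGradient_minGrad h).1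
  · rw [minGrad, dif_neg h]
    refine ⟨aemeasurable_const, fun _ => 0, measurable_const, ?_, fun γ hγ => ?_⟩
    · simp [hp]
    · exact absurd ⟨aemeasurable_const, by simp [UGIneq, lineIntegral, γ.length_pos]⟩ hγ

variable [BorelSpace X]

/-- A function in `L^p_loc` has finite integral along almost every curve: the space is covered by
countably many balls on which the function is `L^p`, and each curve by finitely many of them. -/
theorem MemLpLoc.almostEveryCurve [SecondCountableTopology X] (hp : 0 < p) (hg : MemLpLoc p μ g) :
    AlmostEveryCurve p μ fun γ => lineIntegral γ g ≠ ∞ := by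
  obtain ⟨hgm, hloc⟩ := hg
  choose r hr hfin using hloc
  obtain ⟨S, hS, hcov⟩ := TopologicalSpace.countable_cover_nhds
    fun x : X => Metric.ball_mem_nhds x (hr x)
  have : Countable S := hS.to_subtype
  let G : S → X → ℝ≥0∞ := fun i => (Metric.ball (i : X) (r i)).indicator (hgm.mk g)
  have hG : ∀ i, Measurable (G i) := fun i =>
    hgm.measurable_mk.indicator Metric.isOpen_ball.measurableSet
  have hGI : ∀ i, ∫⁻ x, G i x ^ p ∂μ < ∞ := by
    intro i
    refine lt_of_le_of_lt (le_of_eq ?_) (hfin i)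
    rw [← lintegral_indicator Metric.isOpen_ball.measurableSet]
    refine lintegral_congr_ae ?_
    filter_upwards [hgm.ae_eq_mk] with x hx
    by_cases hxi : x ∈ Metric.ball (i : X) (r i)
    · simp [G, hxi, hx]
    · simp [G, hxi, hp]
  refine ((AlmostEveryCurve.countable_forall hp fun i =>
    almostEveryCurve_lineIntegral_ne_top (hG i) (hGI i)).and hp
    (almostEveryCurve_ae_of_ae hp hgm.ae_eq_mk)).mono fun γ hγ => ?_
  obtain ⟨h1, h2⟩ := hγ
  have hK : IsCompact (γ.toFun '' Icc 0 γ.length) :=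
    isCompact_Icc.image_of_continuousOn γ.continuousOn
  obtain ⟨T, hT⟩ := hK.elim_finite_subcover (fun i : S => Metric.ball (i : X) (r i))
    (fun _ => Metric.isOpen_ball) (by
      intro x _
      have hx : x ∈ ⋃ x ∈ S, Metric.ball x (r x) := hcov ▸ mem_univ x
      simpa using hx)
  have hle : lineIntegral γ g ≤ ∑ i ∈ T, lineIntegral γ (G i) := by
    unfold lineIntegral
    rw [← lintegral_finsetSum' _ fun i _ => γ.aemeasurable_comp (hG i)]
    refine lintegral_mono_ae ?_
    filter_upwards [h2, ae_restrict_mem measurableSet_Icc] with t ht htI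
    obtain ⟨i, hiT, hi⟩ := mem_iUnion₂.1 (hT (mem_image_of_mem _ htI))
    calc g (γ.toFun t) = G i (γ.toFun t) := by simp only [G]; rw [indicator_of_mem hi, ht]
      _ ≤ ∑ i ∈ T, G i (γ.toFun t) :=
        Finset.single_le_sum (f := fun i => G i (γ.toFun t)) (fun _ _ => zero_le) hiT
  exact (hle.trans_lt (ENNReal.sum_lt_top.2 fun i _ => lt_top_iff_ne_top.2 (h1 i))).ne

theorem IsWeakUpperGradient.min [SecondCountableTopology X] (hp : 0 < p)
    (hg : IsWeakUpperGradient p μ g f) (hgl : MemLpLoc p μ g)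
    (hh : IsWeakUpperGradient p μ h f) (hhl : MemLpLoc p μ h) :
    IsWeakUpperGradient p μ (fun x => min (g x) (h x)) f := by
  refine ⟨hg.1.min hh.1, ?_⟩
  refine ((hg.2.and hp hh.2).and hp ((hg.ugIneqOnSubcurves.and hp hh.ugIneqOnSubcurves).and hp
    ((hgl.almostEveryCurve hp).and hp (hhl.almostEveryCurve hp)))).mono ?_
  rintro γ ⟨⟨h1, h2⟩, ⟨h3, h4⟩, h5, h6⟩
  exact ⟨h1.1.min h2.1, h3.ugIneq_min h4 h1.1 h2.1 h5 h6⟩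

/-- A decreasing limit of weak upper gradients in `L^p` is a weak upper gradient, by dominated
convergence along the curves on which the first one has finite integral. -/
theorem IsWeakUpperGradient.iInf [SecondCountableTopology X] (hp : 0 < p) {G : ℕ → X → ℝ≥0∞}
    (hG : ∀ n, IsWeakUpperGradient p μ (G n) f) (hl : MemLpLoc p μ (G 0)) (hanti : Antitone G) :
    IsWeakUpperGradient p μ (fun x => ⨅ n, G n x) f := by
  refine ⟨AEMeasurable.iInf fun n => (hG n).1, ?_⟩
  refine ((AlmostEveryCurve.countable_forall hp fun n => (hG n).2).and hp
    (hl.almostEveryCurve hp)).mono ?_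
  rintro γ ⟨h1, h2⟩
  refine ⟨AEMeasurable.iInf fun n => (h1 n).1, ?_⟩
  rw [UGIneq, lineIntegral, lintegral_iInf' (fun n => (h1 n).1)
    (Filter.Eventually.of_forall fun t m n hmn => hanti hmn (γ.toFun t)) h2]
  exact le_iInf fun n => (h1 n).2

/-- A function with a weak upper gradient in `L^p` has a minimal one: the limit of a decreasing
sequence whose energies tend to the infimum `m` of all energies. The minimum of this limit with any
other weak upper gradient in `L^p_loc` still has energy at least `m`, so it agrees a.e. with the
limit. -/
theorem exists_isMinimalWeakUpperGradient [SecondCountableTopology X] (hp : 0 < p)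
    (hg : IsWeakUpperGradient p μ g f) (hI : ∫⁻ x, g x ^ p ∂μ < ∞) :
    ∃ g₀, IsMinimalWeakUpperGradient p μ g₀ f := by
  let S : Set (X → ℝ≥0∞) := {g | IsWeakUpperGradient p μ g f ∧ ∫⁻ x, g x ^ p ∂μ < ∞}
  have hSloc : ∀ {k}, k ∈ S → MemLpLoc p μ k := fun hk => .of_lintegral_lt_top hk.1.1 hk.2
  have hSmin : ∀ {k l}, k ∈ S → IsWeakUpperGradient p μ l f → MemLpLoc p μ l →
      (fun x => min (k x) (l x)) ∈ S := fun hk hl hl' =>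
    ⟨hk.1.min hp (hSloc hk) hl hl', lt_of_le_of_lt
      (lintegral_mono fun x => ENNReal.rpow_le_rpow (min_le_left _ _) hp.le) hk.2⟩
  let m := ⨅ k ∈ S, ∫⁻ x, k x ^ p ∂μ
  have hm : m ≠ ∞ := ((iInf₂_le g ⟨hg, hI⟩).trans_lt hI).ne
  have hex : ∀ n : ℕ, ∃ k ∈ S, ∫⁻ x, k x ^ p ∂μ < m + ((n : ℝ≥0∞) + 1)⁻¹ := by
    intro n
    have : m < m + ((n : ℝ≥0∞) + 1)⁻¹ := ENNReal.lt_add_right hm (by simp)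
    simpa only [m, iInf_lt_iff, exists_prop] using this
  choose k hkS hkm using hex
  let G : ℕ → X → ℝ≥0∞ := fun n => n.rec (k 0) fun j H x => min (H x) (k (j + 1) x)
  have hGS : ∀ n, G n ∈ S := by
    intro n
    induction n with
    | zero => exact hkS 0
    | succ n ih => exact hSmin ih (hkS _).1 (hSloc (hkS _))
  have hGk : ∀ n x, G n x ≤ k n x := by
    rintro (_ | n) x
    exacts [le_rfl, min_le_right _ _]
  have hanti : Antitone G := antitone_nat_of_succ_le fun n x => min_le_left _ _
  let g₀ : X → ℝ≥0∞ := fun x => ⨅ n, G n x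
  have hg₀m : ∫⁻ x, g₀ x ^ p ∂μ ≤ m := by
    have hlim : Filter.Tendsto (fun n : ℕ => m + ((n : ℝ≥0∞) + 1)⁻¹) Filter.atTop
        (nhds (m + 0)) := by
      refine tendsto_const_nhds.add ?_
      have := (Filter.tendsto_add_atTop_iff_nat 1).2 ENNReal.tendsto_inv_nat_nhds_zero
      simpa using this
    rw [add_zero] at hlim
    refine ge_of_tendsto' hlim fun n => ?_
    refine (lintegral_mono fun x => ENNReal.rpow_le_rpow ?_ hp.le).trans (hkm n).le
    exact (iInf_le _ n).trans (hGk n x)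
  have hg₀S : g₀ ∈ S := ⟨.iInf hp (fun n => (hGS n).1) (hSloc (hGS 0)) hanti,
    hg₀m.trans_lt (lt_top_iff_ne_top.2 hm)⟩
  refine ⟨g₀, hg₀S.1, hSloc hg₀S, fun h hh hhl => ?_⟩
  have hmin := hSmin hg₀S hh hhl
  have hae := ae_eq_of_ae_le_of_lintegral_le (μ := μ)
    (f := fun x => (min (g₀ x) (h x)) ^ p) (g := fun x => g₀ x ^ p)
    (Filter.Eventually.of_forall fun x => ENNReal.rpow_le_rpow (min_le_left _ _) hp.le)
    hmin.2.ne (hg₀S.1.1.pow_const p) (hg₀m.trans (iInf₂_le _ hmin))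
  filter_upwards [hae] with x hx
  have := ENNReal.rpow_left_injective hp.ne' hx
  exact min_eq_left_iff.1 this

theorem minGrad_le [SecondCountableTopology X] (hp : 0 < p)
    (hg : IsWeakUpperGradient p μ g f) (hI : ∫⁻ x, g x ^ p ∂μ < ∞) : minGrad p μ f ≤ᵐ[μ] g :=
  (isMinimalWeakUpperGradient_minGrad (exists_isMinimalWeakUpperGradient hp hg hI)).2.2 g hg
    (.of_lintegral_lt_top hg.1 hI)

end WeakUpperGradient

/-! ### Truncation -/

section Truncation

/-- The truncation of an extended real number to the interval `[0, 1]`, as a real number. -/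
noncomputable def clamp (a : EReal) : ℝ := (max 0 (min a 1)).toReal

theorem coe_clamp (a : EReal) : (clamp a : EReal) = max 0 (min a 1) := by
  refine EReal.coe_toReal ?_ ?_
  · exact ((max_le zero_le_one (min_le_right _ _)).trans_lt (EReal.coe_lt_top 1)).ne
  · exact ((EReal.bot_lt_coe 0).trans_le (le_max_left _ _)).ne'

theorem clamp_nonneg (a : EReal) : 0 ≤ clamp a := by
  rw [← EReal.coe_le_coe_iff, coe_clamp]; exact le_max_left _ _

theorem clamp_le_one (a : EReal) : clamp a ≤ 1 := by
  rw [← EReal.coe_le_coe_iff, coe_clamp]; exact max_le zero_le_one (min_le_right _ _)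

theorem clamp_zero : clamp 0 = 0 := by
  rw [← EReal.coe_eq_coe_iff, coe_clamp]; simp

theorem clamp_eq_one {a : EReal} (ha : 1 ≤ a) : clamp a = 1 := by
  rw [← EReal.coe_eq_coe_iff, coe_clamp]; simp [ha]

theorem le_clamp {c : ℝ} {a : EReal} (hc : c ≤ 1) (h : (c : EReal) ≤ a) : c ≤ clamp a := by
  rw [← EReal.coe_le_coe_iff, coe_clamp]
  exact le_max_of_le_right (le_min h (by exact_mod_cast hc))

theorem clamp_coe (a : ℝ) : clamp a = max 0 (min a 1) := by
  rw [← EReal.coe_eq_coe_iff, coe_clamp, EReal.coe_strictMono.monotone.map_max,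
    EReal.coe_strictMono.monotone.map_min]
  rfl

theorem measurable_clamp : Measurable clamp :=
  (measurable_const.max (measurable_id.min measurable_const)).ereal_toReal

theorem ofReal_abs_clamp_sub_le (a b : EReal) :
    ENNReal.ofReal |clamp a - clamp b| ≤ (a - b).abs := by
  by_cases h : a = ⊤ ∨ a = ⊥ ∨ b = ⊤ ∨ b = ⊥
  · rw [abs_sub_eq_top_of_infinite a b h]; exact le_top
  · push Not at h
    lift a to ℝ using ⟨h.1, h.2.1⟩
    lift b to ℝ using ⟨h.2.2.1, h.2.2.2⟩
    rw [← EReal.coe_sub, EReal.abs_def, clamp_coe, clamp_coe]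
    refine ENNReal.ofReal_le_ofReal ?_
    refine (abs_max_sub_max_le_max _ _ _ _).trans ?_
    refine max_le (by simp) ((abs_min_sub_min_le_max _ _ _ _).trans (max_le le_rfl (by simp)))

theorem ofReal_clamp_le_abs (a : EReal) : ENNReal.ofReal (clamp a) ≤ a.abs := by
  have := ofReal_abs_clamp_sub_le a 0
  rwa [clamp_zero, sub_zero, sub_zero, abs_of_nonneg (clamp_nonneg a)] at this

end Truncation

/-! ### The upper gradient inequality for products and suprema -/

section Calculus

variable {X : Type*} [MetricSpace X]

theorem ugIneq_coe {g : X → ℝ≥0∞} {f : X → ℝ} {γ : ArcCurve X} :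
    UGIneq g (fun x => (f x : EReal)) γ ↔
      ENNReal.ofReal |f (γ.toFun 0) - f (γ.toFun γ.length)| ≤ lineIntegral γ g := by
  rw [UGIneq, ← EReal.coe_sub, EReal.abs_def]

theorem UGIneq.const_mul_clamp {g : X → ℝ≥0∞} {f : X → EReal} {γ : ArcCurve X} {c : ℝ}
    (hc : 0 ≤ c) (h : UGIneq g f γ) :
    UGIneq (fun x => ENNReal.ofReal c * g x) (fun x => ((c * clamp (f x) : ℝ) : EReal)) γ := by
  refine ugIneq_coe.2 ?_
  rw [← mul_sub, abs_mul, abs_of_nonneg hc, ENNReal.ofReal_mul hc]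
  refine le_trans ?_ (lintegral_const_mul_le _ _)
  gcongr
  exact (ofReal_abs_clamp_sub_le _ _).trans h

/-- A Leibniz rule for the product of `v ≥ 0` with a `k`-Lipschitz cutoff function. The factor `2`
avoids differentiation along curves: on a subcurve of length at most `1 / k` the values of `v`
differ from each other by at most the integral of `g`, and longer curves are subdivided. -/
theorem UGIneqOnSubcurves.cutoff_mul {g : X → ℝ≥0∞} {v η : X → ℝ} {γ : ArcCurve X} {k : NNReal}
    (h : UGIneqOnSubcurves g (fun x => (v x : EReal)) γ) (hη : LipschitzWith k η)
    (hη0 : ∀ x, 0 ≤ η x) (hη1 : ∀ x, η x ≤ 1) (hv : ∀ x, 0 ≤ v x) :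
    UGIneq (fun x => 2 * g x + k * ENNReal.ofReal (v x))
      (fun x => ((η x * v x : ℝ) : EReal)) γ := by
  have hsub : ∀ s t, 0 ≤ s → s ≤ t → t ≤ γ.length →
      ENNReal.ofReal |v (γ.toFun s) - v (γ.toFun t)| ≤ ∫⁻ r in Icc s t, g (γ.toFun r) := by
    intro s t hs hst ht
    rcases hst.eq_or_lt with rfl | hlt
    · simp
    · have := h hs hlt ht
      rwa [← EReal.coe_sub, EReal.abs_def] at this
  refine ugIneq_coe.2 ?_
  refine ofReal_abs_sub_le_lintegral_of_locally
    (F := fun r => η (γ.toFun r) * v (γ.toFun r)) γ.length_pos.le fun x _ => ?_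
  -- With this radius, subintervals have length at most `1 / (k + 1)`.
  refine ⟨1 / (2 * (k + 1)), by positivity, fun s t hs hst ht hsx htx => ?_⟩
  set I := ∫⁻ r in Icc s t, g (γ.toFun r) with hI
  have hshort : k * (t - s) ≤ 1 := by
    have h1 : t - s ≤ 1 / (k + 1) := by
      rw [Real.dist_eq, abs_lt] at hsx htx
      have : (1 : ℝ) / (2 * (k + 1)) + 1 / (2 * (k + 1)) = 1 / (k + 1) := by field_simp; norm_num
      linarith
    calc (k : ℝ) * (t - s) ≤ k * (1 / (k + 1)) := by gcongr
      _ ≤ 1 := by rw [mul_one_div, div_le_one (by positivity)]; linarith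
  have hηst : |η (γ.toFun s) - η (γ.toFun t)| ≤ k * (t - s) := by
    have h1 := hη.dist_le_mul (γ.toFun s) (γ.toFun t)
    have h2 := γ.lipschitzOnWith.dist_le_mul s ⟨hs, hst.trans ht⟩ t ⟨hs.trans hst, ht⟩
    rw [Real.dist_eq] at h1
    rw [NNReal.coe_one, one_mul, Real.dist_eq, abs_sub_comm, abs_of_nonneg (sub_nonneg.2 hst)] at h2
    exact h1.trans (by gcongr)
  have hprod : ENNReal.ofReal |η (γ.toFun s) * v (γ.toFun s) - η (γ.toFun t) * v (γ.toFun t)| ≤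
      I + ENNReal.ofReal (k * (t - s)) * ENNReal.ofReal (v (γ.toFun t)) := by
    refine le_trans ?_ (add_le_add_left (hsub s t hs hst ht) _)
    rw [← ENNReal.ofReal_mul (by have := sub_nonneg.2 hst; positivity),
      ← ENNReal.ofReal_add (abs_nonneg _)
        (mul_nonneg (by have := sub_nonneg.2 hst; positivity) (hv _))]
    refine ENNReal.ofReal_le_ofReal ?_
    have e : η (γ.toFun s) * v (γ.toFun s) - η (γ.toFun t) * v (γ.toFun t) =
      η (γ.toFun s) * (v (γ.toFun s) - v (γ.toFun t)) +
        (η (γ.toFun s) - η (γ.toFun t)) * v (γ.toFun t) := by ring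
    rw [e]
    refine (abs_add_le _ _).trans ?_
    rw [abs_mul, abs_mul, abs_of_nonneg (hη0 _), abs_of_nonneg (hv (γ.toFun t))]
    exact add_le_add (mul_le_of_le_one_left (abs_nonneg _) (hη1 _))
      (mul_le_mul_of_nonneg_right hηst (hv _))
  have hosc : ENNReal.ofReal (k * (t - s)) * ENNReal.ofReal (v (γ.toFun t)) ≤
      (∫⁻ r in Icc s t, k * ENNReal.ofReal (v (γ.toFun r))) + I := by
    calc ENNReal.ofReal (k * (t - s)) * ENNReal.ofReal (v (γ.toFun t))
        = ∫⁻ r in Icc s t, k * ENNReal.ofReal (v (γ.toFun t)) := by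
          rw [setLIntegral_const, Real.volume_Icc, ENNReal.ofReal_mul k.coe_nonneg,
            ENNReal.ofReal_coe_nnreal]
          ring
      _ ≤ ∫⁻ r in Icc s t, (k * ENNReal.ofReal (v (γ.toFun r)) + k * I) := by
          refine setLIntegral_mono' measurableSet_Icc fun r hr => ?_
          rw [← mul_add]
          gcongr
          have h1 : ENNReal.ofReal |v (γ.toFun r) - v (γ.toFun t)| ≤ I :=
            (hsub r t (hs.trans hr.1) hr.2 ht).trans
              (lintegral_mono_set (Icc_subset_Icc_left hr.1))
          refine le_trans ?_ (add_le_add_right h1 _)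
          rw [← ENNReal.ofReal_add (hv _) (abs_nonneg _)]
          refine ENNReal.ofReal_le_ofReal ?_
          linarith [neg_abs_le (v (γ.toFun r) - v (γ.toFun t))]
      _ = (∫⁻ r in Icc s t, k * ENNReal.ofReal (v (γ.toFun r))) +
            ENNReal.ofReal (k * (t - s)) * I := by
          rw [lintegral_add_right _ measurable_const, setLIntegral_const, Real.volume_Icc,
            ENNReal.ofReal_mul k.coe_nonneg, ENNReal.ofReal_coe_nnreal]
          ring
      _ ≤ _ := by
          gcongr
          exact mul_le_of_le_one_left zero_le (ENNReal.ofReal_le_one.2 hshort)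
  calc _ ≤ I + ((∫⁻ r in Icc s t, k * ENNReal.ofReal (v (γ.toFun r))) + I) :=
        hprod.trans (add_le_add_right hosc _)
    _ = 2 * I + ∫⁻ r in Icc s t, k * ENNReal.ofReal (v (γ.toFun r)) := by ring
    _ ≤ (∫⁻ r in Icc s t, 2 * g (γ.toFun r)) +
          ∫⁻ r in Icc s t, k * ENNReal.ofReal (v (γ.toFun r)) := by
        gcongr; exact lintegral_const_mul_le _ _
    _ ≤ _ := le_lintegral_add _ _

theorem UGIneq.iSup {ι : Type*} [Nonempty ι] {g : ι → X → ℝ≥0∞} {f : ι → X → ℝ}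
    {γ : ArcCurve X} (hb : ∀ x, BddAbove (range fun i => f i x))
    (h : ∀ i, UGIneq (g i) (fun x => (f i x : EReal)) γ) :
    UGIneq (fun x => ⨆ i, g i x) (fun x => ((⨆ i, f i x : ℝ) : EReal)) γ := by
  refine ugIneq_coe.2 ?_
  rcases eq_or_ne (lineIntegral γ fun x => ⨆ i, g i x) ∞ with htop | htop
  · rw [htop]; exact le_top
  have key : ∀ i, |f i (γ.toFun 0) - f i (γ.toFun γ.length)| ≤
      (lineIntegral γ fun x => ⨆ i, g i x).toReal := fun i =>
    (ENNReal.ofReal_le_iff_le_toReal htop).1 <| (ugIneq_coe.1 (h i)).trans <|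
      lintegral_mono fun t => le_iSup (fun i => g i (γ.toFun t)) i
  rw [ENNReal.ofReal_le_iff_le_toReal htop, abs_sub_le_iff, sub_le_iff_le_add, sub_le_iff_le_add]
  constructor
  · refine ciSup_le fun i => ?_
    linarith [(abs_sub_le_iff.1 (key i)).1, le_ciSup (hb (γ.toFun γ.length)) i]
  · refine ciSup_le fun i => ?_
    linarith [(abs_sub_le_iff.1 (key i)).2, le_ciSup (hb (γ.toFun 0)) i]

end Calculus

/-! ### Newtonian functions -/

section Newton

variable {X : Type*} [MetricSpace X] [MeasurableSpace X] {μ : Measure X} {p : ℝ}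
  {f u : X → EReal} {g : X → ℝ≥0∞}

theorem newtonNorm_rpow (hp : 0 < p) (u : X → EReal) :
    newtonNorm p μ u ^ p = ∫⁻ x, (u x).abs ^ p ∂μ + ∫⁻ x, minGrad p μ u x ^ p ∂μ := by
  rw [newtonNorm, ← ENNReal.rpow_mul, one_div_mul_cancel hp.ne', ENNReal.rpow_one]

theorem MemNewton.lintegral_minGrad_lt_top (hp : 0 < p) (hu : MemNewton p μ u) :
    ∫⁻ x, minGrad p μ u x ^ p ∂μ < ∞ := by
  have h := ENNReal.rpow_lt_top_of_nonneg hp.le hu.2.2.ne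
  rw [newtonNorm_rpow hp] at h
  exact le_add_self.trans_lt h

theorem IsWeakUpperGradient.const_mul_clamp (hg : IsWeakUpperGradient p μ g f) {c : ℝ}
    (hc : 0 ≤ c) : IsWeakUpperGradient p μ (fun x => ENNReal.ofReal c * g x)
      (fun x => ((c * clamp (f x) : ℝ) : EReal)) :=
  ⟨hg.1.const_mul _, hg.2.mono fun _ hγ => ⟨hγ.1.const_mul _, hγ.2.const_mul_clamp hc⟩⟩

theorem IsWeakUpperGradient.iSup {ι : Type*} [Nonempty ι] [Countable ι] (hp : 0 < p)
    {G : ι → X → ℝ≥0∞} {F : ι → X → ℝ} (hb : ∀ x, BddAbove (range fun i => F i x))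
    (h : ∀ i, IsWeakUpperGradient p μ (G i) (fun x => (F i x : EReal))) :
    IsWeakUpperGradient p μ (fun x => ⨆ i, G i x) (fun x => ((⨆ i, F i x : ℝ) : EReal)) :=
  ⟨.iSup fun i => (h i).1, (AlmostEveryCurve.countable_forall hp fun i => (h i).2).mono
    fun _ hγ => ⟨.iSup fun i => (hγ i).1, .iSup hb fun i => (hγ i).2⟩⟩

variable [BorelSpace X]

/-- A weak upper gradient in `L^p` is dominated by a genuine upper gradient in `L^p`: add a function
whose integral is infinite along the exceptional curves. -/
theorem IsWeakUpperGradient.exists_isUpperGradient (hp : 1 ≤ p) (hg : IsWeakUpperGradient p μ g f)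
    (hI : ∫⁻ x, g x ^ p ∂μ < ∞) :
    ∃ g', IsUpperGradient g' f ∧ ∫⁻ x, g' x ^ p ∂μ < ∞ := by
  have hp0 : 0 < p := one_pos.trans_le hp
  obtain ⟨ρ, hρ, hρI, hfail⟩ := hg.2.and hp0 (almostEveryCurve_ae_of_ae hp0 hg.1.ae_eq_mk)
  refine ⟨fun x => hg.1.mk g x + ρ x, ⟨hg.1.measurable_mk.add hρ, fun γ => ?_⟩, ?_⟩
  · by_cases hγ : lineIntegral γ ρ = ∞
    · have : ∞ ≤ lineIntegral γ fun x => hg.1.mk g x + ρ x :=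
        hγ.ge.trans (lintegral_mono fun t => le_add_self)
      exact le_top.trans this
    · obtain ⟨⟨-, h1⟩, h2⟩ := not_not.1 (mt (hfail γ) hγ)
      refine h1.trans ((lintegral_congr_ae h2).le.trans (lintegral_mono fun t => le_self_add))
  · refine ENNReal.lintegral_rpow_add_lt_top_of_lintegral_rpow_lt_top
      hg.1.measurable_mk.aemeasurable ?_ hρI hp
    refine lt_of_le_of_lt (lintegral_congr_ae ?_).le hI
    filter_upwards [hg.1.ae_eq_mk] with x hx
    rw [hx]

theorem IsWeakUpperGradient.memNewton [SecondCountableTopology X] (hp : 1 ≤ p)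
    (hg : IsWeakUpperGradient p μ g f) (hI : ∫⁻ x, g x ^ p ∂μ < ∞) (hf : AEMeasurable f μ)
    (hfI : ∫⁻ x, (f x).abs ^ p ∂μ < ∞) : MemNewton p μ f := by
  have hp0 : 0 < p := one_pos.trans_le hp
  obtain ⟨g', hg', hI'⟩ := hg.exists_isUpperGradient hp hI
  refine ⟨hf, ⟨g', hg', .of_lintegral_lt_top hg'.1.aemeasurable hI'⟩, ?_⟩
  refine ENNReal.rpow_lt_top_of_nonneg (by positivity) (ENNReal.add_ne_top.2 ⟨hfI.ne, ?_⟩)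
  refine ((lintegral_mono_ae ?_).trans_lt hI).ne
  filter_upwards [minGrad_le hp0 hg hI] with x hx
  exact ENNReal.rpow_le_rpow hx hp0.le

theorem IsWeakUpperGradient.cutoff_mul (hp : 0 < p) (hg : IsWeakUpperGradient p μ g f)
    (hf : AEMeasurable f μ) {η : X → ℝ} {k : NNReal} (hη : LipschitzWith k η)
    (hη0 : ∀ x, 0 ≤ η x) (hη1 : ∀ x, η x ≤ 1) :
    IsWeakUpperGradient p μ (fun x => 2 * g x + k * ENNReal.ofReal (clamp (f x)))
      (fun x => ((η x * clamp (f x) : ℝ) : EReal)) := by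
  have hm : AEMeasurable (fun x => (k : ℝ≥0∞) * ENNReal.ofReal (clamp (f x))) μ :=
    ((measurable_clamp.comp_aemeasurable hf).ennreal_ofReal).const_mul _
  refine ⟨(hg.1.const_mul _).add hm, ?_⟩
  refine ((hg.2.and hp hg.ugIneqOnSubcurves).and hp
    (almostEveryCurve_ae_of_ae hp hm.ae_eq_mk)).mono ?_
  rintro γ ⟨⟨h1, h2⟩, h3⟩
  refine ⟨(h1.1.const_mul _).add
    ((γ.aemeasurable_comp hm.measurable_mk).congr (h3.mono fun t ht => ht.symm)), ?_⟩
  refine UGIneqOnSubcurves.cutoff_mul (v := fun x => clamp (f x)) ?_ hη hη0 hη1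
    fun x => clamp_nonneg _
  intro s t hs hst ht
  rw [← EReal.coe_sub, EReal.abs_def]
  exact (ofReal_abs_clamp_sub_le _ _).trans (h2 hs hst ht)

end Newton

/-! ### Cutoff functions -/

section Cutoff

variable {X : Type*} [MetricSpace X]

/-- The `k`-Lipschitz cutoff function `min 1 (k * dist(x, X \ E))`. The extended distance makes it
equal to `1` everywhere if `E = X` and `k ≠ 0`. -/
noncomputable def cutoff (E : Set X) (k : ℕ) (x : X) : ℝ :=
  (min 1 (k * Metric.infEDist x Eᶜ)).toReal

theorem cutoff_nonneg (E : Set X) (k : ℕ) (x : X) : 0 ≤ cutoff E k x := ENNReal.toReal_nonneg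

theorem cutoff_le_one (E : Set X) (k : ℕ) (x : X) : cutoff E k x ≤ 1 :=
  ENNReal.toReal_le_of_le_ofReal zero_le_one (by simp)

theorem cutoff_eq_zero {E : Set X} (k : ℕ) {x : X} (hx : x ∉ E) : cutoff E k x = 0 := by
  simp [cutoff, Metric.infEDist_zero_of_mem (show x ∈ Eᶜ from hx)]

theorem cutoff_eq_one {E : Set X} {k : ℕ} {x : X} (hx : 1 < k * Metric.infEDist x Eᶜ) :
    cutoff E k x = 1 := by
  simp [cutoff, hx.le]

theorem lipschitzWith_cutoff (E : Set X) (k : ℕ) : LipschitzWith (k : NNReal) (cutoff E k) := by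
  refine LipschitzWith.of_le_add_mul _ fun x y => ?_
  have h : min 1 (k * Metric.infEDist x Eᶜ) ≤
      min 1 (k * Metric.infEDist y Eᶜ) + k * edist x y := by
    rw [min_add]
    refine le_min (min_le_of_left_le le_self_add) (min_le_of_right_le ?_)
    rw [← mul_add]
    gcongr
    exact Metric.infEDist_le_infEDist_add_edist
  have hfin : (k : ℝ≥0∞) * edist x y ≠ ∞ := ENNReal.mul_ne_top (by simp) (edist_ne_top x y)
  have h2 := ENNReal.toReal_mono (ENNReal.add_ne_top.2 ⟨by simp, hfin⟩) h
  rw [ENNReal.toReal_add (by simp) hfin, ENNReal.toReal_mul] at h2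
  simpa [cutoff, edist_dist] using h2

end Cutoff

/-! ### Capacities and open neighbourhoods -/

section Capacity

theorem tsum_option (f : Option ℕ → ℝ≥0∞) : ∑' i, f i = f none + ∑' k, f (some k) := by
  rw [← (Equiv.optionEquivSumPUnit.{0} ℕ).symm.tsum_eq f,
    ENNReal.summable.tsum_sum ENNReal.summable, add_comm]
  simp

theorem lintegral_two_mul_add_rpow_le {X : Type*} [MeasurableSpace X] {μ : Measure X} {p : ℝ}
    (hp : 1 ≤ p) {g h : X → ℝ≥0∞} (hg : AEMeasurable g μ)
    {k : ℝ≥0∞} (hk : k ≠ ∞) :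
    ∫⁻ x, (2 * g x + k * h x) ^ p ∂μ ≤
      2 ^ (p - 1) * (2 ^ p + k ^ p) * (∫⁻ x, h x ^ p ∂μ + ∫⁻ x, g x ^ p ∂μ) := by
  have hp0 : 0 ≤ p := zero_le_one.trans hp
  have h2 : (2 : ℝ≥0∞) ^ (p - 1) ≠ ∞ :=
    ENNReal.rpow_ne_top_of_nonneg (sub_nonneg.2 hp) ENNReal.ofNat_ne_top
  calc ∫⁻ x, (2 * g x + k * h x) ^ p ∂μ
      ≤ ∫⁻ x, 2 ^ (p - 1) * (2 ^ p * g x ^ p + k ^ p * h x ^ p) ∂μ := by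
        refine lintegral_mono fun x => ?_
        rw [← ENNReal.mul_rpow_of_nonneg _ _ hp0, ← ENNReal.mul_rpow_of_nonneg _ _ hp0]
        exact ENNReal.rpow_add_le_mul_rpow_add_rpow _ _ hp
    _ = 2 ^ (p - 1) * (2 ^ p * ∫⁻ x, g x ^ p ∂μ + k ^ p * ∫⁻ x, h x ^ p ∂μ) := by
        rw [lintegral_const_mul' _ _ h2, lintegral_add_left' ((hg.pow_const p).const_mul _),
          lintegral_const_mul' _ _ (ENNReal.rpow_ne_top_of_nonneg hp0 ENNReal.ofNat_ne_top),
          lintegral_const_mul' _ _ (ENNReal.rpow_ne_top_of_nonneg hp0 hk)]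
    _ ≤ 2 ^ (p - 1) * ((2 ^ p + k ^ p) * (∫⁻ x, h x ^ p ∂μ + ∫⁻ x, g x ^ p ∂μ)) := by
        rw [add_mul]
        gcongr
        exacts [le_add_self, le_self_add]
    _ = _ := (mul_assoc _ _ _).symm

variable {X : Type*} [MetricSpace X] [MeasurableSpace X] {μ : Measure X} {p : ℝ}

theorem varCap_mono {A B E : Set X} (h : A ⊆ B) : varCap p μ A E ≤ varCap p μ B E :=
  le_iInf₂ fun u hu => le_iInf fun hB => iInf₂_le_of_le u hu <|
    iInf_le (fun _ : ∀ x ∈ A, 1 ≤ u x => ∫⁻ x, minGrad p μ u x ^ p ∂μ) fun x hx => hB x (h hx)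

theorem varCap_le {A E : Set X} {u : X → EReal} (hu : MemNewtonZero p μ E u)
    (h : ∀ x ∈ A, 1 ≤ u x) : varCap p μ A E ≤ ∫⁻ x, minGrad p μ u x ^ p ∂μ :=
  iInf₂_le_of_le u hu (iInf_le _ h)

theorem exists_of_sobolevCap_lt (hp : 0 < p) {G : Set X} {ε : ℝ≥0∞} (h : sobolevCap p μ G < ε) :
    ∃ v, MemNewton p μ v ∧ (∀ x ∈ G, v x = 1) ∧
      ∫⁻ x, (v x).abs ^ p ∂μ + ∫⁻ x, minGrad p μ v x ^ p ∂μ < ε := by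
  simp only [sobolevCap, iInf_lt_iff, exists_prop] at h
  obtain ⟨v, hv, h1, h2⟩ := h
  exact ⟨v, hv, h1, by rwa [newtonNorm_rpow hp] at h2⟩

theorem measure_lt_top_of_isBounded
    (hμ : ∀ (x : X) (r : ℝ), 0 < r → 0 < μ (Metric.ball x r) ∧ μ (Metric.ball x r) < ∞)
    {E : Set X} (hE : Bornology.IsBounded E) : μ E < ∞ := by
  rcases E.eq_empty_or_nonempty with rfl | ⟨x, -⟩
  · simp
  · obtain ⟨r, hr, h⟩ := hE.subset_ball_lt 0 x
    exact (measure_mono h).trans_lt (hμ x r hr).2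

/-- Construction of competitors for open sets. Outside an open set `V k` of small Sobolev
capacity, `u` is continuous, so that `{u > 1 / t}` is relatively open there; on `V k`, at distance
more than `1 / k` from the complement of `E`, a cutoff of a function realizing the small Sobolev
capacity takes over. The cutoff for `k` costs a factor depending on `k`, which is compensated by the
choice of `V k`. Taking the supremum over all `k` reaches all of the interior of `E`. -/
theorem iInf_varCap_le_mul_add [BorelSpace X]
    (hμ : ∀ (x : X) (r : ℝ), 0 < r → 0 < μ (Metric.ball x r) ∧ μ (Metric.ball x r) < ∞)
    (hp : 1 ≤ p) {E : Set X} (hE : Bornology.IsBounded E) {A : Set X} (hA : A ⊆ interior E)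
    {u : X → EReal} (hu : MemNewtonZero p μ E u) (hqc : Quasicontinuous p μ u)
    (huA : ∀ x ∈ A, 1 ≤ u x) {t : ℝ} (ht : 1 < t) {ε : ℝ≥0∞} (hε : ε ≠ 0)
    (hεt : ε ≠ ∞) :
    ⨅ (G : Set X) (_ : IsOpen G) (_ : A ⊆ G) (_ : G ⊆ E), varCap p μ G E ≤
      ENNReal.ofReal t ^ p * ∫⁻ x, minGrad p μ u x ^ p ∂μ + ε := by
  have hp0 : 0 < p := one_pos.trans_le hp
  have ht0 : 0 < t := one_pos.trans ht
  have := secondCountableTopology_of_measure_ball hμ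
  obtain ⟨δ, hδ, hδε⟩ := ENNReal.exists_pos_sum_of_countable' hε ℕ
  -- `C k` bounds the effect of the cutoff with Lipschitz constant `k` on the energy.
  let C : ℕ → ℝ≥0∞ := fun k => 2 ^ (p - 1) * (2 ^ p + (k : ℝ≥0∞) ^ p)
  have hCt : ∀ k, C k ≠ ∞ := fun k => ENNReal.mul_ne_top
    (ENNReal.rpow_ne_top_of_nonneg (by linarith) (by simp)) (ENNReal.add_ne_top.2
      ⟨ENNReal.rpow_ne_top_of_nonneg hp0.le (by simp),
        ENNReal.rpow_ne_top_of_nonneg hp0.le (by simp)⟩)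
  have hcap : ∀ k, ∃ V : Set X, IsOpen V ∧ ContinuousOn u Vᶜ ∧ ∃ v, MemNewton p μ v ∧
      (∀ x ∈ V, v x = 1) ∧
      C k * (∫⁻ x, (v x).abs ^ p ∂μ + ∫⁻ x, minGrad p μ v x ^ p ∂μ) ≤ δ k := by
    intro k
    obtain ⟨V, hV, hVcap, -, hVu⟩ := hqc (δ k / C k) (ENNReal.div_pos (hδ k).ne' (hCt k))
    obtain ⟨v, hv, hv1, hvI⟩ := exists_of_sobolevCap_lt hp0 hVcap
    exact ⟨V, hV, hVu, v, hv, hv1, (mul_le_mul_right hvI.le _).trans ENNReal.mul_div_le⟩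
  choose V hV hVu v hv hv1 hvI using hcap
  have hO : ∀ k, ∃ O : Set X, IsOpen O ∧ u ⁻¹' Ioi ((1 / t : ℝ) : EReal) ∩ (V k)ᶜ = O ∩ (V k)ᶜ :=
    fun k => continuousOn_iff'.1 (hVu k) _ isOpen_Ioi
  choose O hOo hOu using hO
  -- The index `none` stands for the multiple of `u`, and `some k` for the cutoff of `v k`.
  let F : Option ℕ → X → ℝ := fun i x =>
    i.elim (t * clamp (u x)) fun k => cutoff E k x * clamp (v k x)
  let g : Option ℕ → X → ℝ≥0∞ := fun i x =>
    i.elim (ENNReal.ofReal t * minGrad p μ u x)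
      fun k => 2 * minGrad p μ (v k) x + ((k : NNReal) : ℝ≥0∞) * ENNReal.ofReal (clamp (v k x))
  have hF0 : ∀ i x, 0 ≤ F i x := by
    rintro (_ | k) x
    · exact mul_nonneg ht0.le (clamp_nonneg _)
    · exact mul_nonneg (cutoff_nonneg _ _ _) (clamp_nonneg _)
  have hFt : ∀ i x, F i x ≤ t := by
    rintro (_ | k) x
    · exact mul_le_of_le_one_right ht0.le (clamp_le_one _)
    · exact (mul_le_one₀ (cutoff_le_one _ _ _) (clamp_nonneg _) (clamp_le_one _)).trans ht.le
  have hFb : ∀ x, BddAbove (range fun i => F i x) := fun x =>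
    ⟨t, by rintro _ ⟨i, rfl⟩; exact hFt i x⟩
  have hFE : ∀ i, ∀ x ∉ E, F i x = 0 := by
    rintro (_ | k) x hx
    · simp [F, hu.2 x hx, clamp_zero]
    · simp [F, cutoff_eq_zero k hx]
  have hFm : ∀ i, AEMeasurable (F i) μ := by
    rintro (_ | k)
    · exact (measurable_clamp.comp_aemeasurable hu.1.1).const_mul t
    · exact (lipschitzWith_cutoff E k).continuous.measurable.aemeasurable.mul
        (measurable_clamp.comp_aemeasurable (hv k).1)
  have hFg : ∀ i, IsWeakUpperGradient p μ (g i) fun x => (F i x : EReal) := by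
    rintro (_ | k)
    · exact (isWeakUpperGradient_minGrad hp0 μ u).const_mul_clamp ht0.le
    · exact (isWeakUpperGradient_minGrad hp0 μ (v k)).cutoff_mul hp0 (hv k).1
        (lipschitzWith_cutoff E k) (cutoff_nonneg E k) (cutoff_le_one E k)
  let w : X → ℝ := fun x => ⨆ i, F i x
  have hw := IsWeakUpperGradient.iSup hp0 hFb hFg
  have hgsum : ∫⁻ x, (⨆ i, g i x) ^ p ∂μ ≤
      ENNReal.ofReal t ^ p * ∫⁻ x, minGrad p μ u x ^ p ∂μ + ε := by
    calc ∫⁻ x, (⨆ i, g i x) ^ p ∂μ ≤ ∑' i, ∫⁻ x, g i x ^ p ∂μ :=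
          lintegral_iSup_rpow_le_tsum hp0 fun i => (hFg i).1
      _ = ∫⁻ x, g none x ^ p ∂μ + ∑' k : ℕ, ∫⁻ x, g (some k) x ^ p ∂μ :=
          tsum_option _
      _ ≤ _ := by
          gcongr ?_ + ?_
          · simp only [g, Option.elim_none, ENNReal.mul_rpow_of_nonneg _ _ hp0.le]
            rw [lintegral_const_mul' _ _ (ENNReal.rpow_ne_top_of_nonneg hp0.le (by simp))]
          · refine (ENNReal.tsum_le_tsum fun k => ?_).trans hδε.le
            refine (lintegral_two_mul_add_rpow_le hp
              (isWeakUpperGradient_minGrad hp0 μ (v k)).1 ENNReal.coe_ne_top).trans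
                (le_trans ?_ (hvI k))
            simp only [C, ENNReal.coe_natCast]
            gcongr with x
            exact ofReal_clamp_le_abs _
  have hgfin : ∫⁻ x, (⨆ i, g i x) ^ p ∂μ < ∞ := by
    exact hgsum.trans_lt (ENNReal.add_lt_top.2 ⟨ENNReal.mul_lt_top
      (ENNReal.rpow_lt_top_of_nonneg hp0.le (by simp)) (hu.1.lintegral_minGrad_lt_top hp0),
      lt_top_iff_ne_top.2 hεt⟩)
  have hwE : ∀ x ∉ E, w x = 0 := fun x hx => by simp [w, hFE _ x hx]
  have hwI : ∫⁻ x, (w x : EReal).abs ^ p ∂μ < ∞ := by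
    calc ∫⁻ x, (w x : EReal).abs ^ p ∂μ
        ≤ ∫⁻ x, (toMeasurable μ E).indicator (fun _ => ENNReal.ofReal t ^ p) x ∂μ := by
          refine lintegral_mono fun x => ?_
          by_cases hx : x ∈ E
          · rw [indicator_of_mem (subset_toMeasurable μ E hx), EReal.abs_def]
            refine ENNReal.rpow_le_rpow (ENNReal.ofReal_le_ofReal ?_) hp0.le
            rw [abs_of_nonneg (Real.iSup_nonneg fun i => hF0 i x)]
            exact ciSup_le fun i => hFt i x
          · simp [hwE x hx, hp0]
      _ = ENNReal.ofReal t ^ p * μ E := by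
          rw [lintegral_indicator_const (measurableSet_toMeasurable μ E), measure_toMeasurable]
      _ < ∞ := ENNReal.mul_lt_top (ENNReal.rpow_lt_top_of_nonneg hp0.le (by simp))
          (measure_lt_top_of_isBounded hμ hE)
  have hwN : MemNewtonZero p μ E fun x => (w x : EReal) :=
    ⟨hw.memNewton hp hgfin (AEMeasurable.iSup hFm).coe_real_ereal hwI,
      fun x hx => by simp [hwE x hx]⟩
  let W : ℕ → Set X := fun k => {x | 1 < (k : ℝ≥0∞) * Metric.infEDist x Eᶜ}
  have hWo : ∀ k, IsOpen (W k) := fun k => isOpen_lt continuous_const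
    (ENNReal.continuous_const_mul (by simp) |>.comp Metric.continuous_infEDist)
  have hWE : ∀ k, W k ⊆ E := by
    intro k x hx
    by_contra hxE
    simp [W, Metric.infEDist_zero_of_mem (show x ∈ Eᶜ from hxE)] at hx
  let G : Set X := ⋃ k, (O k ∪ V k) ∩ W k
  have hG : IsOpen G := isOpen_iUnion fun k => ((hOo k).union (hV k)).inter (hWo k)
  have hGE : G ⊆ E := iUnion_subset fun k => inter_subset_right.trans (hWE k)
  have hAG : A ⊆ G := by
    intro x hx
    have hpos : Metric.infEDist x Eᶜ ≠ 0 := by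
      rw [Ne, ← Metric.mem_closure_iff_infEDist_zero, closure_compl]
      exact not_not.2 (hA hx)
    obtain ⟨k, hk⟩ := ENNReal.exists_nat_mul_gt hpos ENNReal.one_ne_top
    refine mem_iUnion.2 ⟨k, ?_, hk⟩
    by_cases hxV : x ∈ V k
    · exact Or.inr hxV
    · have hxu : x ∈ u ⁻¹' Ioi ((1 / t : ℝ) : EReal) ∩ (V k)ᶜ := by
        refine ⟨lt_of_lt_of_le ?_ (huA x hx), hxV⟩
        exact_mod_cast (div_lt_one ht0).2 ht
      rw [hOu k] at hxu
      exact Or.inl hxu.1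
  have hwG : ∀ x ∈ G, 1 ≤ w x := by
    intro x hx
    obtain ⟨k, hxOV, hxW⟩ := mem_iUnion.1 hx
    by_cases hxV : x ∈ V k
    · refine le_trans (le_of_eq ?_) (le_ciSup (hFb x) (some k))
      simp [F, cutoff_eq_one hxW, hv1 k x hxV, clamp_eq_one]
    · have hxu : x ∈ O k ∩ (V k)ᶜ := ⟨hxOV.resolve_right hxV, hxV⟩
      rw [← hOu k] at hxu
      have h1 : 1 / t ≤ clamp (u x) := le_clamp ((div_le_one ht0).2 ht.le) hxu.1.le
      exact ((div_le_iff₀' ht0).1 h1).trans (le_ciSup (hFb x) none)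
  calc _ ≤ varCap p μ G E := iInf₂_le_of_le G hG (iInf₂_le_of_le hAG hGE le_rfl)
    _ ≤ ∫⁻ x, minGrad p μ (fun x => (w x : EReal)) x ^ p ∂μ :=
        varCap_le hwN fun x hx => by exact_mod_cast hwG x hx
    _ ≤ ∫⁻ x, (⨆ i, g i x) ^ p ∂μ := by
        refine lintegral_mono_ae ?_
        filter_upwards [minGrad_le hp0 hw hgfin] with x hx
        exact ENNReal.rpow_le_rpow hx hp0.le
    _ ≤ _ := hgsum

/-- The variational capacity is outer on subsets of the interior of `E`, for every `p ≥ 1`. -/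
theorem varCap_eq_iInf_isOpen [BorelSpace X]
    (hμ : ∀ (x : X) (r : ℝ), 0 < r → 0 < μ (Metric.ball x r) ∧ μ (Metric.ball x r) < ∞)
    (hp : 1 ≤ p) (hqc : ∀ u : X → EReal, MemNewton p μ u → Quasicontinuous p μ u)
    {E : Set X} (hE : Bornology.IsBounded E) {A : Set X} (hA : A ⊆ interior E) :
    varCap p μ A E =
      ⨅ (G : Set X) (_ : IsOpen G) (_ : A ⊆ G) (_ : G ⊆ E), varCap p μ G E := by
  have hp0 : 0 < p := one_pos.trans_le hp
  refine le_antisymm (le_iInf₂ fun G _ => le_iInf₂ fun hAG _ => varCap_mono hAG) ?_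
  refine le_iInf₂ fun u hu => le_iInf fun huA => ?_
  have hle : ∀ t : ℝ, 1 < t →
      ⨅ (G : Set X) (_ : IsOpen G) (_ : A ⊆ G) (_ : G ⊆ E), varCap p μ G E ≤
        ENNReal.ofReal t ^ p * ∫⁻ x, minGrad p μ u x ^ p ∂μ := fun t ht =>
    ENNReal.le_of_forall_pos_le_add fun ε hε _ =>
      iInf_varCap_le_mul_add hμ hp hE hA hu (hqc u hu.1) huA ht (by simpa using hε.ne')
        ENNReal.coe_ne_top
  have hlim : Filter.Tendsto
      (fun t : ℝ => ENNReal.ofReal t ^ p * ∫⁻ x, minGrad p μ u x ^ p ∂μ) (nhdsWithin 1 (Ioi 1))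
      (nhds (ENNReal.ofReal 1 ^ p * ∫⁻ x, minGrad p μ u x ^ p ∂μ)) := by
    refine ENNReal.Tendsto.mul_const ?_ (Or.inr (hu.1.lintegral_minGrad_lt_top hp0).ne)
    exact ((ENNReal.continuous_rpow_const.comp ENNReal.continuous_ofReal).tendsto 1).mono_left
      nhdsWithin_le_nhds
  rw [ENNReal.ofReal_one, ENNReal.one_rpow, one_mul] at hlim
  exact ge_of_tendsto hlim (eventually_nhdsWithin_of_forall fun t ht => hle t ht)

end Capacity

theorem subset_interior_of_setDist_pos {X : Type*} [MetricSpace X] {A E : Set X}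
    (h : 0 < setDist A Eᶜ) : A ⊆ interior E := by
  intro x hx
  have h1 : Metric.infEDist x Eᶜ ≠ 0 := by
    refine (h.trans_le ?_).ne'
    exact iInf₂_le x hx
  rwa [Ne, ← Metric.mem_closure_iff_infEDist_zero, closure_compl, notMem_compl_iff] at h1

end Newtonian

theorem theorem4p1 {X : Type*} [MetricSpace X] [MeasurableSpace X] [BorelSpace X]
    (μ : Measure X)
    (hμ : ∀ (x : X) (r : ℝ), 0 < r → 0 < μ (Metric.ball x r) ∧ μ (Metric.ball x r) < ∞)
    (p : ℝ) (hp : 1 ≤ p)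
    (hqc : ∀ u : X → EReal, Newtonian.MemNewton p μ u → Newtonian.Quasicontinuous p μ u)
    (E : Set X) (hE : Bornology.IsBounded E) :
    (1 < p → ∀ A : Set X, A ⊆ interior E →
      Newtonian.varCap p μ A E =
        ⨅ (G : Set X) (_ : IsOpen G) (_ : A ⊆ G) (_ : G ⊆ E), Newtonian.varCap p μ G E) ∧
    (p = 1 → ∀ A : Set X, A ⊆ E → 0 < Newtonian.setDist A Eᶜ →
      Newtonian.varCap p μ A E =
        ⨅ (G : Set X) (_ : IsOpen G) (_ : A ⊆ G) (_ : G ⊆ E), Newtonian.varCap p μ G E) :=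
  ⟨fun _ _ hA => Newtonian.varCap_eq_iInf_isOpen hμ hp hqc hE hA,
    fun _ _ _ hd => Newtonian.varCap_eq_iInf_isOpen hμ hp hqc hE
      (Newtonian.subset_interior_of_setDist_pos hd)⟩
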